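/- Let $\mathbb H$ be the upper half-plane, let $\kappa\in\tfrac12\mathbf Z$ with $\kappa\ge\tfrac12$, and let $\Gamma\subseteq \mathrm{SL}_2(\mathbf Z)$ be a congruence subgroup; if $\kappa\notin\mathbf Z$, assume that $\Gamma\subseteq\Gamma_0(4)$. Let $M_\kappa(\Gamma)$ be the space of holomorphic functions $f:\mathbb H\to\mathbf C$ such that, for all $\gamma=\begin{pmatrix}a&b\\c_\gamma&d\end{pmatrix}\in\Gamma$ and $\tau\in\mathbb H$, $$f(\gamma\tau)=(c_\gamma\tau+d)^{\kappa}f(\tau)\quad(\kappa\in\mathbf Z),\qquad f(\gamma\tau)=\Bigl(\frac{\theta(\gamma\tau)}{\theta(\tau)}\Bigr)^{2\kappa}f(\tau)\quad(\kappa\notin\mathbf Z),$$ where $\theta(\tau)=\sum_{n\in\mathbf Z}e^{2\pi i n^2\tau}$, and such that $f$ is holomorphic at every cusp, that is, $(c_\gamma\tau+d)^{-\kappa}f(\gamma\tau)$ is bounded as $\mathrm{Im}\,\tau\to\infty$ for every $\gamma\in\mathrm{SL}_2(\mathbf Z)$. Such an $f$ is a cusp form if $(c_\gamma\tau+d)^{-\kappa}f(\gamma\tau)\to0$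 as $\mathrm{Im}\,\tau\to\infty$ for every $\gamma\in\mathrm{SL}_2(\mathbf Z)$. Let $f\in M_\kappa(\Gamma)$ be non-zero, let $M\ge1$ be an integer with $f(\tau+M)=f(\tau)$ for all $\tau$, and let $$f(\tau)=\sum_{n\ge0}a_f(n)\,e^{2\pi i n\tau/M}$$ be the Fourier expansion of $f$ at the cusp $\infty$. If for some real $c<\kappa-1$ there is a constant $C$ with $|a_f(n)|\le C\,n^{c}$ for all $n\ge1$, then $f$ is a cusp form. -/

import Mathlib

open UpperHalfPlane CongruenceSubgroup
open scoped MatrixGroups ModularForm Manifold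

namespace HalfIntegralWeight

/-- The theta function `θ(τ) = ∑_{n ∈ ℤ} q ^ (n ^ 2)` with `q = exp (2 π i τ)`. Mathlib's
`jacobiTheta τ` is `∑_{n ∈ ℤ} exp (π i n ^ 2 τ)`. -/
noncomputable def theta (τ : ℍ) : ℂ :=
  jacobiTheta (2 * (τ : ℂ))

/-- The automorphy factor of weight `k / 2` for an integer `k`. If the weight is integral it is
the usual `(c τ + d) ^ (k / 2)`. If the weight is half-integral (`k` odd) it is
`(θ (γ τ) / θ τ) ^ k`, which is meant for `γ ∈ Γ₀(4)` only. -/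
noncomputable def autFactor (k : ℤ) (γ : SL(2, ℤ)) (τ : ℍ) : ℂ :=
  if Even k then denom γ τ ^ (k / 2) else (theta (γ • τ) / theta τ) ^ k

/-- The function `τ ↦ (c τ + d) ^ (-k / 2) * f (γ τ)` for `γ ∈ SL(2, ℤ)`, with the principal
branch of the power. It is used only to describe `f` at the cusp `γ ∞`; another choice of the
square root of `c τ + d` changes it by a constant of absolute value `1`. -/
noncomputable def atCusp (k : ℤ) (γ : SL(2, ℤ)) (f : ℍ → ℂ) (τ : ℍ) : ℂ :=
  denom γ τ ^ (-((k : ℂ) / 2)) * f (γ • τ)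

/-- `f` is an (elliptic) modular form of weight `k / 2` on `Γ`: it is holomorphic on the upper
half-plane, transforms under `Γ` with the automorphy factor of weight `k / 2`, and is holomorphic
at every cusp. For odd `k` the group `Γ` has to be contained in `Γ₀(4)`. -/
structure IsModularForm (k : ℤ) (Γ : Subgroup SL(2, ℤ)) (f : ℍ → ℂ) : Prop where
  holo : MDiff f
  map_smul : ∀ γ ∈ Γ, ∀ τ : ℍ, f (γ • τ) = autFactor k γ τ * f τ
  bdd_at_cusps : ∀ γ : SL(2, ℤ), IsBoundedAtImInfty (atCusp k γ f)

/-- `f` is a cusp form of weight `k / 2` on `Γ`: a modular form that vanishes at every cusp. -/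
structure IsCuspForm (k : ℤ) (Γ : Subgroup SL(2, ℤ)) (f : ℍ → ℂ) : Prop
    extends IsModularForm k Γ f where
  zero_at_cusps : ∀ γ : SL(2, ℤ), IsZeroAtImInfty (atCusp k γ f)

/-- For integral weight `m`, the function `atCusp` is Mathlib's slash action. -/
lemma atCusp_two_mul (m : ℤ) (γ : SL(2, ℤ)) (f : ℍ → ℂ) :
    atCusp (2 * m) γ f = f ∣[m] γ := by
  funext τ
  rw [ModularForm.SL_slash_apply, atCusp, mul_comm]
  congr 1
  rw [← Complex.cpow_intCast]
  congr 1
  push_cast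
  ring

/-- For integral weight `m`, transformation under `γ` is invariance under the slash action. -/
lemma map_smul_two_mul (m : ℤ) (γ : SL(2, ℤ)) (f : ℍ → ℂ) :
    (∀ τ : ℍ, f (γ • τ) = autFactor (2 * m) γ τ * f τ) ↔ f ∣[m] γ = f := by
  rw [funext_iff]
  refine forall_congr' fun τ => ?_
  have h : denom γ τ ^ m ≠ 0 := zpow_ne_zero _ (denom_ne_zero _ τ)
  rw [ModularForm.SL_slash_apply, autFactor, if_pos (even_two_mul m),
    Int.mul_ediv_cancel_left m two_ne_zero, zpow_neg, ← div_eq_mul_inv, div_eq_iff h,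
    mul_comm (f τ)]

/-- For integral weight `m`, `IsModularForm` is Mathlib's notion of a modular form. -/
lemma isModularForm_two_mul_iff (m : ℤ) {Γ : Subgroup SL(2, ℤ)} (hΓ : IsCongruenceSubgroup Γ)
    (f : ℍ → ℂ) :
    IsModularForm (2 * m) Γ f ↔
      ∃ F : ModularForm (Γ.map (Matrix.SpecialLinearGroup.mapGL ℝ)) m, ⇑F = f := by
  have := hΓ.finiteIndex
  constructor
  · intro h
    refine ⟨⟨⟨f, ?_⟩, h.holo, ?_⟩, rfl⟩
    · rintro _ ⟨γ, hγ, rfl⟩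
      exact (map_smul_two_mul m γ f).1 (h.map_smul γ hγ)
    · intro c hc
      have hc' := (Subgroup.IsArithmetic.isCusp_iff_isCusp_SL2Z _).1 hc
      rw [OnePoint.isBoundedAt_iff_forall_SL2Z hc']
      intro γ _
      have := h.bdd_at_cusps γ
      rwa [atCusp_two_mul] at this
  · rintro ⟨F, rfl⟩
    refine ⟨F.holo', fun γ hγ => ?_, fun γ => ?_⟩
    · exact (map_smul_two_mul m γ F).2 (F.slash_action_eq' _ ⟨γ, hγ, rfl⟩)
    · rw [atCusp_two_mul]
      have hc : IsCusp (Matrix.SpecialLinearGroup.mapGL ℝ γ • OnePoint.infty)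
          (MonoidHom.range (Matrix.SpecialLinearGroup.mapGL ℝ : SL(2, ℤ) →* GL (Fin 2) ℝ)) :=
        isCusp_SL2Z_iff'.2 ⟨γ, rfl⟩
      exact (OnePoint.isBoundedAt_iff_forall_SL2Z hc).1
        (F.bdd_at_cusps' ((Subgroup.IsArithmetic.isCusp_iff_isCusp_SL2Z _).2 hc)) γ rfl

/-- For integral weight `m`, `IsCuspForm` is Mathlib's notion of a cusp form. -/
lemma isCuspForm_two_mul_iff (m : ℤ) {Γ : Subgroup SL(2, ℤ)} (hΓ : IsCongruenceSubgroup Γ)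
    (f : ℍ → ℂ) :
    IsCuspForm (2 * m) Γ f ↔
      ∃ F : CuspForm (Γ.map (Matrix.SpecialLinearGroup.mapGL ℝ)) m, ⇑F = f := by
  have := hΓ.finiteIndex
  constructor
  · intro h
    refine ⟨⟨⟨f, ?_⟩, h.holo, ?_⟩, rfl⟩
    · rintro _ ⟨γ, hγ, rfl⟩
      exact (map_smul_two_mul m γ f).1 (h.map_smul γ hγ)
    · intro c hc
      have hc' := (Subgroup.IsArithmetic.isCusp_iff_isCusp_SL2Z _).1 hc
      rw [OnePoint.isZeroAt_iff_forall_SL2Z hc']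
      intro γ _
      have := h.zero_at_cusps γ
      rwa [atCusp_two_mul] at this
  · rintro ⟨F, rfl⟩
    have hz : ∀ γ : SL(2, ℤ), IsZeroAtImInfty (atCusp (2 * m) γ F) := by
      intro γ
      rw [atCusp_two_mul]
      have hc : IsCusp (Matrix.SpecialLinearGroup.mapGL ℝ γ • OnePoint.infty)
          (MonoidHom.range (Matrix.SpecialLinearGroup.mapGL ℝ : SL(2, ℤ) →* GL (Fin 2) ℝ)) :=
        isCusp_SL2Z_iff'.2 ⟨γ, rfl⟩
      exact (OnePoint.isZeroAt_iff_forall_SL2Z hc).1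
        (F.zero_at_cusps' ((Subgroup.IsArithmetic.isCusp_iff_isCusp_SL2Z _).2 hc)) γ rfl
    exact ⟨⟨F.holo', fun γ hγ => (map_smul_two_mul m γ F).2 (F.slash_action_eq' _ ⟨γ, hγ, rfl⟩),
      fun γ => (hz γ).isBoundedAtImInfty⟩, hz⟩

/-- The Fourier coefficients of `f` at the cusp `∞` with respect to the period `M`: if
`f (τ + M) = f τ`, then `f τ = ∑_{n ≥ 0} fourierCoeff M f n * exp (2 π i n τ / M)`. -/
noncomputable def fourierCoeff (M : ℕ) (f : ℍ → ℂ) (n : ℕ) : ℂ :=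
  (qExpansion (M : ℝ) f).coeff n

/-- The Fourier expansion of a modular form `f` of period `M` has the coefficients
`fourierCoeff M f`. -/
lemma hasSum_fourierCoeff {k : ℤ} {Γ : Subgroup SL(2, ℤ)} {f : ℍ → ℂ} (hf : IsModularForm k Γ f)
    {M : ℕ} (hM : 0 < M) (hper : ∀ τ : ℍ, f ((M : ℝ) +ᵥ τ) = f τ) (τ : ℍ) :
    HasSum (fun n : ℕ => fourierCoeff M f n *
      Complex.exp (2 * Real.pi * Complex.I * n * τ / M)) (f τ) := by
  have hb : IsBoundedAtImInfty f := by
    have h := hf.bdd_at_cusps 1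
    have h1 : atCusp k 1 f = f := by
      funext z
      simp [atCusp]
    rwa [h1] at h
  have hp : Function.Periodic (f ∘ ofComplex) ((M : ℝ) : ℂ) := by
    intro w
    by_cases! hw : 0 < w.im
    · have hw' : 0 < (w + ((M : ℝ) : ℂ)).im := by simpa using hw
      simp only [Function.comp_apply, ofComplex_apply_of_im_pos hw', ofComplex_apply_of_im_pos hw]
      rw [← hper ⟨w, hw⟩]
      congr 1
      ext
      simp [add_comm]
    · have hw' : (w + ((M : ℝ) : ℂ)).im ≤ 0 := by simpa using hw
      simp only [Function.comp_apply, ofComplex_apply_of_im_nonpos hw, ofComplex_apply_of_im_nonpos hw']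
  have h := hasSum_qExpansion (h := (M : ℝ)) (by exact_mod_cast hM) hp hf.holo hb τ
  convert! h using 2 with n
  rw [fourierCoeff, smul_eq_mul, Function.Periodic.qParam, ← Complex.exp_nat_mul]
  congr 2
  push_cast
  ring

end HalfIntegralWeight

namespace HalfIntegralWeight

open Filter Topology

/-! Write `κ = k / 2`, `y = im τ`, and choose `p` with `max 0 (c + 1) < p < κ`. The coefficient
bound gives `‖f τ‖ ≤ A + B * y ^ (-p)` (`exists_norm_le_im_rpow`). If `γ` has non-zero lower left
entry, then `im (γ τ)` is of order `1 / y` on vertical strips of bounded width, so `f` at the cusp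
`γ ∞` is `O(y ^ (-κ) + y ^ (p - κ))` and tends to `0` (`isZeroAtImInfty_atCusp`). The cusp `∞` is no
exception, since `Γ(N) ≤ Γ` moves it to a representative of that kind.

Only absolute values matter, so all that is needed of the automorphy factor is that its norm is `‖c
τ + d‖ ^ κ`. For odd `k` this rests on the invariance of `‖θ‖ ^ 4 * im` under `Γ₀(4)`
(`thetaNorm_smul`), which needs no multiplier system. -/

/-! ### Invariance of `‖θ‖ ^ 4 * im` under `Γ₀(4)` -/

/-- The function `‖ϑ(z)‖ ^ 4 * im z`, where `ϑ` is Mathlib's Jacobi theta function. -/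
noncomputable def jacobiNorm (z : ℂ) : ℝ :=
  ‖jacobiTheta z‖ ^ 4 * z.im

lemma jacobiNorm_add_two_mul_int (z : ℂ) (n : ℤ) : jacobiNorm (z + n * 2) = jacobiNorm z := by
  have h : Function.Periodic jacobiTheta 2 := fun w => by rw [add_comm, jacobiTheta_two_add]
  rw [jacobiNorm, jacobiNorm, h.int_mul n z]
  simp

lemma jacobiNorm_neg_inv {z : ℂ} (hz : 0 < z.im) : jacobiNorm (-z)⁻¹ = jacobiNorm z := by
  have h := jacobiTheta_S_smul ⟨z, hz⟩
  rw [modular_S_smul] at h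
  have hz0 : z ≠ 0 := by rintro rfl; simp at hz
  have h' : ‖jacobiTheta (-z)⁻¹‖ = ‖z‖ ^ (1 / 2 : ℝ) * ‖jacobiTheta z‖ := by
    have := congrArg norm h
    rw [norm_mul] at this
    convert this using 2
    have h2 : (1 / 2 : ℂ) = ((1 / 2 : ℝ) : ℂ) := by push_cast; rfl
    rw [h2, Complex.norm_cpow_real]
    simp
  have h4 : (‖z‖ ^ (1 / 2 : ℝ)) ^ 4 = Complex.normSq z := by
    rw [← Real.rpow_natCast, ← Real.rpow_mul (norm_nonneg z), Complex.normSq_eq_norm_sq,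
      ← Real.rpow_natCast]
    norm_num
  have hn : Complex.normSq z ≠ 0 := by simpa using hz0
  rw [jacobiNorm, jacobiNorm, h', mul_pow, h4, Complex.inv_im]
  simp only [Complex.neg_im, neg_neg, Complex.normSq_neg]
  field_simp

/-- The function `‖θ(τ)‖ ^ 4 * im τ`. -/
noncomputable def thetaNorm (τ : ℍ) : ℝ :=
  ‖theta τ‖ ^ 4 * τ.im

lemma jacobiNorm_two_mul (τ : ℍ) : jacobiNorm (2 * (τ : ℂ)) = 2 * thetaNorm τ := by
  simp [jacobiNorm, thetaNorm, theta]
  ring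

lemma thetaNorm_T_zpow_smul (τ : ℍ) (n : ℤ) : thetaNorm (ModularGroup.T ^ n • τ) = thetaNorm τ := by
  have h := jacobiNorm_add_two_mul_int (2 * (τ : ℂ)) n
  rw [show 2 * (τ : ℂ) + n * 2 = 2 * ((ModularGroup.T ^ n • τ : ℍ) : ℂ) by
    rw [ModularGroup.coe_T_zpow_smul_eq]; ring, jacobiNorm_two_mul, jacobiNorm_two_mul] at h
  linarith

/-- The lower triangular unipotent matrix with entry `n`. -/
def lowerUnipotent (n : ℤ) : SL(2, ℤ) :=
  ⟨!![1, 0; n, 1], by simp [Matrix.det_fin_two]⟩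

lemma coe_lowerUnipotent_smul (n : ℤ) (τ : ℍ) :
    ((lowerUnipotent n • τ : ℍ) : ℂ) = τ / (n * τ + 1) := by
  rw [UpperHalfPlane.coe_specialLinearGroup_apply]
  simp [lowerUnipotent]

/-- In the variable `w = 2 τ` this matrix is the translation by `-2 n` conjugated by `w ↦ -1 / w`,
and both maps preserve `jacobiNorm`. -/
lemma thetaNorm_lowerUnipotent_smul (τ : ℍ) (n : ℤ) :
    thetaNorm (lowerUnipotent (4 * n) • τ) = thetaNorm τ := by
  set w : ℂ := 2 * (τ : ℂ) with hw
  have hwi : 0 < w.im := by simpa [hw] using τ.im_pos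
  have hw0 : w ≠ 0 := by intro h; simp [h] at hwi
  have hsi : 0 < ((-w)⁻¹ + ((-n : ℤ) : ℂ) * 2).im := by
    have := Complex.normSq_pos.2 hw0
    simp only [Complex.add_im, Complex.inv_im, Complex.neg_im, Complex.normSq_neg, neg_neg]
    simp
    positivity
  have hd : ((4 * n : ℤ) : ℂ) * τ + 1 ≠ 0 := by
    intro h
    have := congrArg Complex.im h
    simp [τ.im_ne_zero] at this
    subst this
    simp at h
  have h : -((-w)⁻¹ + ((-n : ℤ) : ℂ) * 2) = (2 * n * w + 1) / w := by
    push_cast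
    field_simp
    ring
  have key : (-((-w)⁻¹ + ((-n : ℤ) : ℂ) * 2))⁻¹
      = 2 * ((lowerUnipotent (4 * n) • τ : ℍ) : ℂ) := by
    rw [coe_lowerUnipotent_smul, h, inv_div, hw]
    push_cast
    ring_nf
  have h1 := jacobiNorm_neg_inv hsi
  rw [key, jacobiNorm_add_two_mul_int, jacobiNorm_neg_inv hwi, jacobiNorm_two_mul, hw,
    jacobiNorm_two_mul] at h1
  linarith

lemma exists_two_mul_abs_add_mul_le (d : ℤ) {c : ℤ} (hc : c ≠ 0) :
    ∃ m : ℤ, 2 * |d + c * m| ≤ |c| := by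
  have h0 := Int.emod_nonneg d hc
  have h1 := Int.emod_lt_abs d hc
  have h2 := Int.emod_add_mul_ediv d c
  by_cases h : 2 * (d % c) ≤ |c|
  · refine ⟨-(d / c), ?_⟩
    rw [show d + c * -(d / c) = d % c by linarith, abs_of_nonneg h0]
    exact h
  · refine ⟨-(d / c) - c.sign, ?_⟩
    have h3 : c * c.sign = |c| := by rw [mul_comm, Int.sign_mul_self_eq_abs]
    rw [show d + c * (-(d / c) - c.sign) = d % c - |c| by rw [← h3]; linarith,
      abs_of_neg (by linarith)]
    linarith

/-- Euclid's algorithm on the lower row reduces a matrix of `Γ₀(4)` to a translation. -/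
lemma thetaNorm_smul {γ : SL(2, ℤ)} (hγ : γ ∈ Gamma0 4) (τ : ℍ) :
    thetaNorm (γ • τ) = thetaNorm τ := by
  rw [Gamma0_mem] at hγ
  replace hγ : (4 : ℤ) ∣ γ 1 0 := (ZMod.intCast_zmod_eq_zero_iff_dvd _ 4).1 hγ
  induction hn : (γ 1 0).natAbs using Nat.strong_induction_on generalizing γ τ with
  | _ n ih =>
  by_cases hc : γ 1 0 = 0
  · obtain ⟨m, hm⟩ := ModularGroup.exists_eq_T_zpow_of_c_eq_zero hc
    rw [hm, thetaNorm_T_zpow_smul]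
  obtain ⟨m, hm⟩ := exists_two_mul_abs_add_mul_le (γ 1 1) hc
  set d := γ 1 1 + γ 1 0 * m with hd
  have hdet : γ 0 0 * γ 1 1 - γ 0 1 * γ 1 0 = 1 := by
    have := γ.det_coe
    rwa [Matrix.det_fin_two] at this
  obtain ⟨r, hr⟩ := hγ
  have hodd : Odd (γ 1 1) := by
    rw [← Int.not_even_iff_odd]
    rintro ⟨s, hs⟩
    rw [hr, hs] at hdet
    have : 2 * (γ 0 0 * s - γ 0 1 * (2 * r)) = 1 := by linarith
    omega
  have hdodd : Odd d := by
    rw [hd, hr]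
    exact hodd.add_even ⟨2 * r * m, by ring⟩
  obtain ⟨t, ht⟩ := hdodd
  -- Right multiplication by `T ^ m` replaces the lower right entry by `d`; the lower unipotent
  -- factor then changes the lower left entry by multiples of `4 * d`. Here `d ≠ 0` because it is
  -- odd.
  obtain ⟨l, hl⟩ := exists_two_mul_abs_add_mul_le (γ 1 0) (c := 4 * d) (by omega)
  set δ := γ * ModularGroup.T ^ m * lowerUnipotent (4 * l) with hδ
  have hδ10 : δ 1 0 = γ 1 0 + 4 * d * l := by
    rw [hδ, Matrix.SpecialLinearGroup.coe_mul, Matrix.SpecialLinearGroup.coe_mul,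
      ModularGroup.coe_T_zpow]
    simp [lowerUnipotent, Matrix.mul_apply, Fin.sum_univ_two, hd]
    ring
  have h4 : (4 : ℤ) ∣ δ 1 0 := by
    rw [hδ10, hr]
    exact ⟨r + d * l, by ring⟩
  -- The roundings give `|δ 1 0| ≤ 2 |d| ≤ |γ 1 0|`. The first inequality is strict: `4 ∣ δ 1 0`,
  -- while `2 d` is `2` modulo `4`.
  have hlt : (δ 1 0).natAbs < n := by
    rw [← hn]
    zify
    rw [← hδ10, abs_mul, show |(4 : ℤ)| = 4 from rfl] at hl
    obtain ⟨s, hs⟩ := h4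
    have hs' : |δ 1 0| = 4 * |s| := by rw [hs, abs_mul]; rfl
    rcases abs_choice d with h | h <;> omega
  have h := ih _ hlt ((lowerUnipotent (4 * l))⁻¹ • (ModularGroup.T ^ m)⁻¹ • τ) h4 rfl
  have h1 := thetaNorm_lowerUnipotent_smul
    ((lowerUnipotent (4 * l))⁻¹ • (ModularGroup.T ^ m)⁻¹ • τ) l
  have h2 := thetaNorm_T_zpow_smul ((ModularGroup.T ^ m)⁻¹ • τ) m
  rw [smul_inv_smul] at h1 h2
  rw [hδ, mul_smul, mul_smul, smul_inv_smul, smul_inv_smul] at h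
  rw [h, ← h1, h2]

/-! ### The invariant norm of a modular form -/

/-- The function `‖f(τ)‖ * (im τ) ^ (κ / 2)` for the weight `κ = k / 2`. -/
noncomputable def invNorm (k : ℤ) (f : ℍ → ℂ) (τ : ℍ) : ℝ :=
  ‖f τ‖ * τ.im ^ ((k : ℝ) / 4)

lemma im_smul_eq (γ : SL(2, ℤ)) (τ : ℍ) : (γ • τ).im = τ.im / ‖denom γ τ‖ ^ 2 := by
  rw [ModularGroup.im_smul_eq_div_normSq, Complex.normSq_eq_norm_sq]

lemma norm_denom_pos (γ : SL(2, ℤ)) (τ : ℍ) : 0 < ‖denom γ τ‖ :=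
  norm_pos_iff.2 (denom_ne_zero _ τ)

lemma im_smul_rpow (γ : SL(2, ℤ)) (τ : ℍ) (k : ℤ) :
    (γ • τ).im ^ ((k : ℝ) / 4) = τ.im ^ ((k : ℝ) / 4) * ‖denom γ τ‖ ^ (-((k : ℝ) / 2)) := by
  have hd := norm_denom_pos γ τ
  rw [im_smul_eq, Real.div_rpow τ.im_pos.le (by positivity), Real.rpow_neg hd.le, div_eq_mul_inv,
    ← Real.rpow_natCast, ← Real.rpow_mul hd.le]
  congr 3
  push_cast
  ring

/-- The exponent is real, so the branch of the power disappears in the norm, and behaviour at cusps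
becomes a question about the `Γ`-invariant function `invNorm`. -/
lemma norm_atCusp (k : ℤ) (γ : SL(2, ℤ)) (f : ℍ → ℂ) (τ : ℍ) :
    ‖atCusp k γ f τ‖ = invNorm k f (γ • τ) * τ.im ^ (-((k : ℝ) / 4)) := by
  have h : (-((k : ℂ) / 2)) = ((-((k : ℝ) / 2) : ℝ) : ℂ) := by push_cast; rfl
  have h1 : τ.im ^ ((k : ℝ) / 4) ≠ 0 := (Real.rpow_pos_of_pos τ.im_pos _).ne'
  rw [atCusp, norm_mul, h, Complex.norm_cpow_real, invNorm, im_smul_rpow,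
    Real.rpow_neg τ.im_pos.le]
  field_simp

lemma norm_theta_smul {γ : SL(2, ℤ)} (hγ : γ ∈ Gamma0 4) (τ : ℍ) :
    ‖theta (γ • τ)‖ = ‖denom γ τ‖ ^ (1 / 2 : ℝ) * ‖theta τ‖ := by
  have h := thetaNorm_smul hγ τ
  have hd := norm_denom_pos γ τ
  rw [thetaNorm, thetaNorm, im_smul_eq] at h
  have hy := τ.im_pos
  have h4 : (‖denom γ τ‖ ^ (1 / 2 : ℝ)) ^ 4 = ‖denom γ τ‖ ^ 2 := by
    rw [← Real.rpow_natCast, ← Real.rpow_mul hd.le, ← Real.rpow_natCast]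
    norm_num
  refine (pow_left_inj₀ (norm_nonneg _) (by positivity) (four_ne_zero)).1 ?_
  rw [mul_pow, h4]
  field_simp at h
  linarith

/-- Although `θ` has no zeros, this fact is not needed: where `θ τ = 0`, the transformation laws for
`γ` and `γ⁻¹` show that both sides vanish. -/
lemma norm_smul_of_isModularForm {k : ℤ} (hk : 1 ≤ k) {Γ : Subgroup SL(2, ℤ)}
    (hΓ4 : Odd k → Γ ≤ Gamma0 4) {f : ℍ → ℂ} (hf : IsModularForm k Γ f) {γ : SL(2, ℤ)}
    (hγ : γ ∈ Γ) (τ : ℍ) : ‖f (γ • τ)‖ = ‖denom γ τ‖ ^ ((k : ℝ) / 2) * ‖f τ‖ := by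
  have hd := norm_denom_pos γ τ
  have h := hf.map_smul γ hγ τ
  rcases Int.even_or_odd k with hev | hodd
  · rw [h, autFactor, if_pos hev, norm_mul, norm_zpow, ← Real.rpow_intCast]
    obtain ⟨m, rfl⟩ := hev
    congr 2
    rw [show (m + m) / 2 = m by omega]
    push_cast
    ring
  have hne : ¬ Even k := Int.not_even_iff_odd.2 hodd
  have hθ := norm_theta_smul (hΓ4 hodd hγ) τ
  by_cases h0 : theta τ = 0
  · have h0' : theta (γ • τ) = 0 := by simpa [h0] using hθ
    -- The factor for `γ⁻¹` has denominator `θ (γ τ) = 0`; with `x / 0 = 0` and `k ≠ 0` it is `0`,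
    -- which forces `f τ = 0`.
    have h' := hf.map_smul γ⁻¹ (inv_mem hγ) (γ • τ)
    rw [inv_smul_smul, autFactor, if_neg hne, h0', div_zero, zero_zpow _ (by omega),
      zero_mul] at h'
    rw [h, h']
    simp
  · rw [h, autFactor, if_neg hne, norm_mul, norm_zpow, norm_div, hθ,
      mul_div_cancel_right₀ _ (norm_ne_zero_iff.2 h0), ← Real.rpow_intCast, ← Real.rpow_mul hd.le]
    congr 2
    ring

lemma invNorm_smul {k : ℤ} (hk : 1 ≤ k) {Γ : Subgroup SL(2, ℤ)}
    (hΓ4 : Odd k → Γ ≤ Gamma0 4) {f : ℍ → ℂ} (hf : IsModularForm k Γ f) {γ : SL(2, ℤ)}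
    (hγ : γ ∈ Γ) (τ : ℍ) : invNorm k f (γ • τ) = invNorm k f τ := by
  have h := Real.rpow_pos_of_pos (norm_denom_pos γ τ) ((k : ℝ) / 2)
  rw [invNorm, invNorm, norm_smul_of_isModularForm hk hΓ4 hf hγ, im_smul_rpow,
    Real.rpow_neg (norm_nonneg _)]
  field_simp

/-! ### Growth towards the real line -/

/-- Raise `x / p ≤ exp (x / p)` to the power `p`. -/
lemma exp_neg_le_rpow_neg {p x : ℝ} (hp : 0 < p) (hx : 0 < x) :
    Real.exp (-x) ≤ p ^ p * x ^ (-p) := by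
  have h1 : x / p ≤ Real.exp (x / p) := by linarith [Real.add_one_le_exp (x / p)]
  have h2 : (x / p) ^ p ≤ Real.exp x := by
    refine (Real.rpow_le_rpow (by positivity) h1 hp.le).trans_eq ?_
    rw [← Real.exp_mul]
    congr 1
    field_simp
  rw [Real.div_rpow hx.le hp.le, div_le_iff₀ (by positivity)] at h2
  rw [Real.exp_neg, Real.rpow_neg hx.le, inv_le_iff_one_le_mul₀ (Real.exp_pos x)]
  have : 0 < x ^ p := by positivity
  field_simp
  linarith

/-- Trading each exponential for a power, with `x = 2 π n y / M`, factors `y ^ (-p)` out of the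
series and leaves `∑ n ^ (c - p)`, which converges because `p > c + 1`. The constant term accounts
for `A`. -/
lemma exists_norm_le_im_rpow {f : ℍ → ℂ} {a : ℕ → ℂ} {M : ℕ} (hM : 0 < M)
    (hsum : ∀ τ : ℍ, HasSum (fun n : ℕ => a n *
      Complex.exp (2 * Real.pi * Complex.I * n * τ / M)) (f τ)) {C c p : ℝ}
    (ha : ∀ n : ℕ, 1 ≤ n → ‖a n‖ ≤ C * (n : ℝ) ^ c) (hp : 0 < p) (hcp : c + 1 < p) :
    ∃ A B : ℝ, 0 ≤ A ∧ 0 ≤ B ∧ ∀ τ : ℍ, ‖f τ‖ ≤ A + B * τ.im ^ (-p) := by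
  have hC : 0 ≤ C := by
    have := (norm_nonneg _).trans (ha 1 le_rfl)
    simpa using this
  have hS : Summable fun n : ℕ => ((n + 1 : ℕ) : ℝ) ^ (c - p) :=
    (summable_nat_add_iff 1).2 (Real.summable_nat_rpow.2 (by linarith))
  set t : ℝ := 2 * Real.pi / M with ht
  have htpos : 0 < t := by positivity
  refine ⟨‖a 0‖, C * p ^ p * t ^ (-p) * ∑' n : ℕ, ((n + 1 : ℕ) : ℝ) ^ (c - p), norm_nonneg _,
    mul_nonneg (by positivity) (tsum_nonneg fun n => by positivity), fun τ => ?_⟩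
  have hy := τ.im_pos
  have hterm : ∀ n : ℕ, ‖a (n + 1) * Complex.exp (2 * Real.pi * Complex.I * (n + 1 : ℕ) * τ / M)‖ ≤
      C * p ^ p * t ^ (-p) * τ.im ^ (-p) * ((n + 1 : ℕ) : ℝ) ^ (c - p) := by
    intro n
    have hn : (0 : ℝ) < ((n + 1 : ℕ) : ℝ) := by positivity
    have he : ‖Complex.exp (2 * Real.pi * Complex.I * (n + 1 : ℕ) * τ / M)‖ =
        Real.exp (-(((n + 1 : ℕ) : ℝ) * (t * τ.im))) := by
      rw [Complex.norm_exp]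
      congr 1
      rw [show (2 * Real.pi * Complex.I * (n + 1 : ℕ) * τ / M : ℂ) =
        ((t * ((n + 1 : ℕ) : ℝ) : ℝ) : ℂ) * (τ * Complex.I) by rw [ht]; push_cast; ring,
        Complex.re_ofReal_mul, Complex.mul_I_re, UpperHalfPlane.coe_im]
      ring
    rw [norm_mul, he]
    have h1 := ha (n + 1) (by omega)
    have h2 := exp_neg_le_rpow_neg hp (x := ((n + 1 : ℕ) : ℝ) * (t * τ.im)) (by positivity)
    refine (mul_le_mul h1 h2 (Real.exp_pos _).le (by positivity)).trans_eq ?_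
    rw [Real.mul_rpow hn.le (by positivity), Real.mul_rpow htpos.le hy.le, sub_eq_add_neg,
      Real.rpow_add hn]
    ring
  have h := (hasSum_nat_add_iff' 1).2 (hsum τ)
  have h1 := h.norm_le_of_bounded (hS.mul_left (C * p ^ p * t ^ (-p) * τ.im ^ (-p))).hasSum hterm
  rw [tsum_mul_left] at h1
  simp only [Finset.sum_range_one, Nat.cast_zero, mul_zero, zero_mul, zero_div, Complex.exp_zero,
    mul_one] at h1
  calc ‖f τ‖ ≤ ‖a 0‖ + ‖f τ - a 0‖ := by
        simpa using norm_add_le (a 0) (f τ - a 0)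
    _ ≤ _ := by
        gcongr
        refine h1.trans_eq ?_
        ring

/-! ### Behaviour at the cusps -/

/-- On this region `‖c τ + d‖` lies between `im τ` and a constant multiple of it, the lower bound
because `|c| ≥ 1`. -/
lemma exists_im_smul_bounds {γ : SL(2, ℤ)} (hγ : γ 1 0 ≠ 0) (N : ℝ) :
    ∃ D : ℝ, 0 < D ∧ ∀ τ : ℍ, 0 ≤ τ.re → τ.re ≤ N → 1 ≤ τ.im →
      (γ • τ).im ≤ τ.im⁻¹ ∧ (D * τ.im)⁻¹ ≤ (γ • τ).im := by
  refine ⟨(|(γ 1 0 : ℝ)| * (|N| + 1) + |(γ 1 1 : ℝ)| + 1) ^ 2, by positivity, fun τ h0 hN h1 => ?_⟩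
  have hy := τ.im_pos
  have hden : denom γ τ = (γ 1 0 : ℂ) * τ + γ 1 1 := by
    simp [denom]
  have hd := norm_denom_pos γ τ
  have hc : (1 : ℝ) ≤ |(γ 1 0 : ℝ)| := by
    exact_mod_cast Int.one_le_abs hγ
  have hlow : τ.im ≤ ‖denom γ τ‖ := by
    have h := Complex.abs_im_le_norm (denom γ τ)
    rw [hden] at h ⊢
    simp only [Complex.add_im, Complex.mul_im, Complex.intCast_re, Complex.intCast_im,
      UpperHalfPlane.coe_im, zero_mul, add_zero, abs_mul, abs_of_pos hy] at h
    nlinarith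
  have hτ : ‖(τ : ℂ)‖ ≤ (|N| + 1) * τ.im := by
    have h := Complex.norm_le_abs_re_add_abs_im (τ : ℂ)
    rw [UpperHalfPlane.coe_re, UpperHalfPlane.coe_im, abs_of_nonneg h0, abs_of_pos hy] at h
    have := le_abs_self N
    nlinarith [abs_nonneg N]
  have hup : ‖denom γ τ‖ ≤ (|(γ 1 0 : ℝ)| * (|N| + 1) + |(γ 1 1 : ℝ)| + 1) * τ.im := by
    rw [hden]
    refine (norm_add_le _ _).trans ?_
    rw [norm_mul, Complex.norm_intCast, Complex.norm_intCast]
    have := mul_le_mul_of_nonneg_left hτ (abs_nonneg (γ 1 0 : ℝ))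
    nlinarith [abs_nonneg (γ 1 1 : ℝ)]
  rw [im_smul_eq]
  constructor
  · rw [div_le_iff₀ (by positivity), inv_mul_eq_div, le_div_iff₀ hy]
    nlinarith
  · rw [le_div_iff₀ (by positivity), inv_mul_eq_div, div_le_iff₀ (by positivity)]
    calc ‖denom γ τ‖ ^ 2 ≤ ((|(γ 1 0 : ℝ)| * (|N| + 1) + |(γ 1 1 : ℝ)| + 1) * τ.im) ^ 2 := by
          gcongr
      _ = _ := by ring

lemma norm_atCusp_mul_left {k : ℤ} (hk : 1 ≤ k) {Γ : Subgroup SL(2, ℤ)}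
    (hΓ4 : Odd k → Γ ≤ Gamma0 4) {f : ℍ → ℂ} (hf : IsModularForm k Γ f) {δ : SL(2, ℤ)}
    (hδ : δ ∈ Γ) (γ : SL(2, ℤ)) (τ : ℍ) : ‖atCusp k (δ * γ) f τ‖ = ‖atCusp k γ f τ‖ := by
  rw [norm_atCusp, norm_atCusp, mul_smul, invNorm_smul hk hΓ4 hf hδ]

lemma norm_atCusp_T_zpow_smul {k : ℤ} (hk : 1 ≤ k) {Γ : Subgroup SL(2, ℤ)}
    (hΓ4 : Odd k → Γ ≤ Gamma0 4) {f : ℍ → ℂ} (hf : IsModularForm k Γ f) {N : ℕ}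
    (hN : Gamma N ≤ Γ) (γ : SL(2, ℤ)) (m : ℤ) (τ : ℍ) :
    ‖atCusp k γ f (ModularGroup.T ^ (N * m) • τ)‖ = ‖atCusp k γ f τ‖ := by
  -- `Γ(N)` is normal, so the conjugate of this translation by `γ` lies in `Γ` and can be absorbed
  -- on the left.
  have hT : ModularGroup.T ^ (N * m) ∈ Gamma N := by
    rw [Gamma_mem, ModularGroup.coe_T_zpow]
    simp
  have hδ := hN ((Gamma_normal N).conj_mem _ hT γ)
  rw [← norm_atCusp_mul_left hk hΓ4 hf hδ γ τ, norm_atCusp, norm_atCusp,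
    inv_mul_cancel_right, mul_smul, ← UpperHalfPlane.coe_im (ModularGroup.T ^ (N * m) • τ),
    ModularGroup.coe_T_zpow_smul_eq]
  simp

lemma isZeroAtImInfty_atCusp {k : ℤ} (hk : 1 ≤ k) {Γ : Subgroup SL(2, ℤ)}
    (hΓ4 : Odd k → Γ ≤ Gamma0 4) {f : ℍ → ℂ} (hf : IsModularForm k Γ f) {N : ℕ} (hN0 : N ≠ 0)
    (hN : Gamma N ≤ Γ) {A B p : ℝ} (hA : 0 ≤ A) (hB : 0 ≤ B) (hp : 0 < p)
    (hpk : p < (k : ℝ) / 2) (hgrowth : ∀ τ : ℍ, ‖f τ‖ ≤ A + B * τ.im ^ (-p)) {γ : SL(2, ℤ)}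
    (hγ : γ 1 0 ≠ 0) : IsZeroAtImInfty (atCusp k γ f) := by
  have hk0 : (0 : ℝ) < k := by exact_mod_cast hk
  have hNpos : (0 : ℝ) < N := by positivity
  obtain ⟨D, hD, hbd⟩ := exists_im_smul_bounds hγ N
  have hstrip : ∀ τ : ℍ, 0 ≤ τ.re → τ.re ≤ N → 1 ≤ τ.im → ‖atCusp k γ f τ‖ ≤
      A * τ.im ^ (-((k : ℝ) / 2)) + B * D ^ p * τ.im ^ (-((k : ℝ) / 2 - p)) := by
    intro τ h0 h1 hy1
    obtain ⟨hup, hlow⟩ := hbd τ h0 h1 hy1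
    have hy := τ.im_pos
    have hY := (γ • τ).im_pos
    have e1 : (γ • τ).im ^ ((k : ℝ) / 4) ≤ τ.im ^ (-((k : ℝ) / 4)) := by
      rw [Real.rpow_neg hy.le, ← Real.inv_rpow hy.le]
      exact Real.rpow_le_rpow hY.le hup (by positivity)
    have e2 : (γ • τ).im ^ (-p) ≤ D ^ p * τ.im ^ p := by
      rw [← Real.mul_rpow hD.le hy.le, Real.rpow_neg hY.le, ← Real.inv_rpow hY.le]
      exact Real.rpow_le_rpow (by positivity) (inv_le_of_inv_le₀ (by positivity) hlow) hp.le
    have e3 : ‖f (γ • τ)‖ ≤ A + B * (D ^ p * τ.im ^ p) := (hgrowth _).trans (by gcongr)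
    rw [norm_atCusp, invNorm]
    calc ‖f (γ • τ)‖ * (γ • τ).im ^ ((k : ℝ) / 4) * τ.im ^ (-((k : ℝ) / 4))
        ≤ (A + B * (D ^ p * τ.im ^ p)) * τ.im ^ (-((k : ℝ) / 4)) * τ.im ^ (-((k : ℝ) / 4)) := by
          gcongr
      _ = (A + B * (D ^ p * τ.im ^ p)) * τ.im ^ (-((k : ℝ) / 2)) := by
          rw [mul_assoc, ← Real.rpow_add hy]
          congr 2
          ring
      _ = _ := by
          rw [show -((k : ℝ) / 2 - p) = p + -((k : ℝ) / 2) by ring, Real.rpow_add hy]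
          ring
  have hlim : Tendsto (fun y : ℝ => A * y ^ (-((k : ℝ) / 2)) +
      B * D ^ p * y ^ (-((k : ℝ) / 2 - p))) atTop (𝓝 0) := by
    have h1 := (tendsto_rpow_neg_atTop (y := (k : ℝ) / 2) (by positivity)).const_mul A
    have h2 := (tendsto_rpow_neg_atTop (y := (k : ℝ) / 2 - p) (by linarith)).const_mul (B * D ^ p)
    simpa using h1.add h2
  refine squeeze_zero_norm' ?_ (hlim.comp (tendsto_comap (f := UpperHalfPlane.im)))
  have hev : ∀ᶠ τ : ℍ in atImInfty, 1 ≤ τ.im :=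
    (tendsto_comap (f := UpperHalfPlane.im)).eventually (eventually_ge_atTop 1)
  filter_upwards [hev] with τ hτ
  -- Translating by `N * m` brings `τ` into the strip `0 ≤ re ≤ N` without changing the norm, so the
  -- strip estimate holds uniformly in `re τ`.
  set m : ℤ := -⌊τ.re / N⌋ with hm
  have hre : (ModularGroup.T ^ ((N : ℤ) * m) • τ).re = τ.re - N * ⌊τ.re / N⌋ := by
    rw [ModularGroup.re_T_zpow_smul, hm]
    push_cast
    ring
  have him : (ModularGroup.T ^ ((N : ℤ) * m) • τ).im = τ.im := ModularGroup.im_T_zpow_smul _ _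
  have hf1 := Int.floor_le (τ.re / N)
  have hf2 := (Int.lt_floor_add_one (τ.re / N)).le
  rw [le_div_iff₀ hNpos] at hf1
  rw [div_le_iff₀ hNpos] at hf2
  have h := hstrip (ModularGroup.T ^ ((N : ℤ) * m) • τ) (by rw [hre]; linarith)
    (by rw [hre]; linarith) (by rwa [him])
  rwa [norm_atCusp_T_zpow_smul hk hΓ4 hf hN, him] at h

/-- If the lower left entry is `0`, the determinant makes the upper left entry non-zero, and adding
`N` times the first row to the second suffices. -/
lemma exists_mem_Gamma_mul_apply_ne_zero {N : ℕ} (hN : N ≠ 0) (γ : SL(2, ℤ)) :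
    ∃ δ ∈ Gamma N, (δ * γ) 1 0 ≠ 0 := by
  by_cases hc : γ 1 0 = 0
  · refine ⟨lowerUnipotent N, ?_, ?_⟩
    · rw [Gamma_mem]
      simp [lowerUnipotent]
    · have hdet := γ.det_coe
      rw [Matrix.det_fin_two, hc] at hdet
      have ha : γ 0 0 ≠ 0 := by
        intro h
        simp [h] at hdet
      rw [Matrix.SpecialLinearGroup.coe_mul]
      have h : (lowerUnipotent N * γ : Matrix (Fin 2) (Fin 2) ℤ) 1 0 = N * γ 0 0 := by
        rw [Matrix.mul_apply, Fin.sum_univ_two, hc]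
        simp [lowerUnipotent]
      rw [h]
      exact mul_ne_zero (by exact_mod_cast hN) ha
  · exact ⟨1, one_mem _, by simpa using hc⟩

end HalfIntegralWeight

open HalfIntegralWeight in
theorem mainTheorem2 (k : ℤ) (hk : 1 ≤ k)
    (Γ : Subgroup SL(2, ℤ)) (hΓ : IsCongruenceSubgroup Γ) (hΓ4 : Odd k → Γ ≤ Gamma0 4)
    (f : ℍ → ℂ) (hf : HalfIntegralWeight.IsModularForm k Γ f) (hf0 : f ≠ 0)
    (M : ℕ) (hM : 0 < M) (hper : ∀ τ : ℍ, f ((M : ℝ) +ᵥ τ) = f τ)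
    (c : ℝ) (hc : c < (k : ℝ) / 2 - 1)
    (hbound : ∃ C : ℝ, ∀ n : ℕ, 1 ≤ n →
      ‖HalfIntegralWeight.fourierCoeff M f n‖ ≤ C * (n : ℝ) ^ c) :
    HalfIntegralWeight.IsCuspForm k Γ f := by
  refine ⟨hf, fun γ => ?_⟩
  obtain ⟨C, hC⟩ := hbound
  obtain ⟨N, hN0, hN⟩ := hΓ
  have hk0 : (0 : ℝ) < k := by exact_mod_cast hk
  -- The hypothesis `c < κ - 1` is exactly what leaves room for `p` between `c + 1` and `κ`; the
  -- maximum with `0` covers `c ≤ -1`.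
  obtain ⟨p, hp, hpk⟩ : ∃ p, max 0 (c + 1) < p ∧ p < (k : ℝ) / 2 :=
    exists_between (max_lt (by positivity) (by linarith))
  rw [max_lt_iff] at hp
  obtain ⟨A, B, hA, hB, hgrowth⟩ :=
    exists_norm_le_im_rpow hM (hasSum_fourierCoeff hf hM hper) hC hp.1 hp.2
  obtain ⟨δ, hδ, hne⟩ := exists_mem_Gamma_mul_apply_ne_zero hN0 γ
  have h := isZeroAtImInfty_atCusp hk hΓ4 hf hN0 hN hA hB hp.1 hpk hgrowth hne
  rw [isZeroAtImInfty_iff] at h ⊢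
  simpa only [norm_atCusp_mul_left hk hΓ4 hf (hN hδ)] using h
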